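/- **Conventions.** For a Polish space $X$ let $\Delta(X)$ be the space of Borel probability measures on $X$ with the weak topology; each measure is identified with its completion, so $\mu(B)=1$ includes that $B$ is $\mu$-measurable. A subset of a Polish space is universally measurable if it is measurable for the completion of every Borel probability measure on the space; a function is universally measurable if preimages of Borel sets are universally measurable. Below $i\in\{1,2\}$ is a player and $j$ is the other player. *Rationalizability.* Let $X_1,X_2$ be Polish spaces and let $E=(E_1,E_2)$ with $E_i\subseteq X_i\times\Delta(X_j)$. A rectangle $B_1\times B_2\subseteq X_1\times X_2$ is $E$-justified if for both $i$ and every $s\in B_i$ there is $\mu\in\Delta(X_j)$ with $(s,\mu)\in E_i$ and $\mu(B_j)=1$. Let $\mathrm{RAT}(E)_i$ be the union of the $i$-th sides of all $E$-justified rectangles, and $\mathrm{RAT}(E)=\mathrm{RAT}(E)_1\times\mathrm{RAT}(E)_2$. *Types.* Let $X_i^0=X_j$ and $X_i^{n+1}=X_i^n\times\Delta(X_j^n)$. A sequence $\delta=(\delta^1,\delta^2,\dots)\in T_i^0=\prod_{n\ge 1}\Delta(X_i^{n-1})$ is coherent if the marginal of $\delta^{n+1}$ on $X_i^{n-1}$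 is $\delta^n$ for every $n\ge1$; it then has a unique extension $\delta^*\in\Delta(X_j\times T_j^0)$ whose marginal on $X_i^n$ is $\delta^{n+1}$ for every $n\ge 0$. Let $T_i^1$ be the set of coherent sequences, $T_i^{k+1}=\{\delta\in T_i^1:\delta^*(X_j\times T_j^k)=1\}$, and $T_i=\bigcap_k T_i^k$ (the universal type space); for $t\in T_i$ let $\lambda_i(t)\in\Delta(X_j\times T_j)$ be $t^*$ regarded as a measure on $X_j\times T_j$. *Common belief.* Let $\mathrm{RCBR}(E)_i^1=\{(s,t)\in X_i\times T_i:(s,\mathrm{marg}_{X_j}\lambda_i(t))\in E_i\}$ and $\mathrm{RCBR}(E)_i^{n+1}=\{(s,t)\in\mathrm{RCBR}(E)_i^n:\lambda_i(t)(\mathrm{RCBR}(E)_j^n)=1\}$. Let $\mathrm{RCBR}(E)_i$ be the set of $s\in X_i$ such that for some $t\in T_i$ one has $(s,t)\in\mathrm{RCBR}(E)_i^n$ for all $n\ge1$, and $\mathrm{RCBR}(E)=\mathrm{RCBR}(E)_1\times\mathrm{RCBR}(E)_2$. *Games.* A game is a pair of bounded universally measurable payoff functions $\pi_1,\pi_2:X_1\times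 X_2\to\mathbb R$ on Polish strategy spaces. Its best response relation $E_i\subseteq X_i\times\Delta(X_j)$ consists of the pairs $(s,\mu)$ such that $s$ maximizes player $i$'s expected payoff against $\mu$ among all strategies in $X_i$. The rationalizable strategies of player $i$ are those that survive all stages of the transfinite deletion $X_i^{(0)}=X_i$, $X_i^{(\alpha+1)}=\{s\in X_i^{(\alpha)}:\exists\mu\in\Delta(X_j),\ (s,\mu)\in E_i,\ \mu(X_j^{(\alpha)})=1\}$, with intersections at limit stages. A strategy of player $i$ is consistent with rationality and common belief in rationality (RCBR) if it belongs to $\mathrm{RCBR}(E)_i$ for the pair $E=(E_1,E_2)$ of best response relations. **Theorem.** Assume the Continuum Hypothesis. 1. There is a game with strategy spaces $X_1=X_2=[0,2]$ and bounded (universally measurable) payoffs, whose best response relations are both universally measurable, in which the strategy $0$ is, for each player, rationalizable but not consistent with rationality and common belief in rationality. 2. For any nonempty perfect Polish spaces $X_1,X_2$ there are universally measurable relations $E_i\subseteq X_i\times\Delta(X_j)$, $i=1,2$, such that $\mathrm{RAT}(E)\ne\mathrm{RCBR}(E)$. -/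

import Mathlib

open MeasureTheory ProbabilityTheory Set Filter Topology
open scoped NNReal

universe u

namespace Epistemic

/-! ### Spaces of Borel probability measures -/

theorem giry_le_borel (K : Type*) [TopologicalSpace K] [MeasurableSpace K] [BorelSpace K]
    [HasOuterApproxClosed K] :
    (inferInstance : MeasurableSpace (ProbabilityMeasure K)) ≤ borel (ProbabilityMeasure K) := by
  let m : MeasurableSpace (ProbabilityMeasure K) := borel _
  have : BorelSpace (ProbabilityMeasure K) := ⟨rfl⟩
  have h : @Measurable _ _ m _ (fun μ : ProbabilityMeasure K => (μ : Measure K)) := by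
    refine Measurable.measure_of_isPiSystem_of_isProbabilityMeasure
      (BorelSpace.measurable_eq (α := K)) isPiSystem_isOpen fun s hs => ?_
    have hl : LowerSemicontinuous fun μ : ProbabilityMeasure K => (μ : Measure K) s :=
      lowerSemicontinuous_iff_le_liminf.2 fun μ =>
        ProbabilityMeasure.le_liminf_measure_open_of_tendsto tendsto_id hs
    exact hl.measurable
  exact (MeasurableSpace.comap_le_iff_le_map).2 h

theorem borel_le_giry (K : Type*) [TopologicalSpace K] [SecondCountableTopology K]
    [MeasurableSpace K] [BorelSpace K] [HasOuterApproxClosed K] :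
    borel (ProbabilityMeasure K) ≤ (inferInstance : MeasurableSpace (ProbabilityMeasure K)) := by
  obtain ⟨B, hBc, -, hB⟩ := TopologicalSpace.exists_countable_basis K
  let S : Set (Set K) := (fun f => ⋂₀ f) '' {f : Set (Set K) | f.Finite ∧ f ⊆ B}
  have hSb : TopologicalSpace.IsTopologicalBasis S :=
    TopologicalSpace.isTopologicalBasis_of_subbasis hB.eq_generateFrom
  have hSc : S.Countable := (countable_ofPred_finite_subset hBc).image _
  have hSpi : IsPiSystem S := by
    rintro _ ⟨f, ⟨hf, hf'⟩, rfl⟩ _ ⟨g, ⟨hg, hg'⟩, rfl⟩ -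
    exact ⟨f ∪ g, ⟨hf.union hg, union_subset hf' hg'⟩, sInter_union f g⟩
  have hSm : ∀ s ∈ S, MeasurableSet s := fun s hs => (hSb.isOpen hs).measurableSet
  have : Countable S := hSc.to_subtype
  let ev : ProbabilityMeasure K → S → ℝ≥0 := fun μ s => μ s
  have hle : TopologicalSpace.induced ev Pi.topologicalSpace ≤
      ProbabilityMeasure.instTopologicalSpace := by
    refine le_of_nhds_le_nhds fun μ => ?_
    rw [nhds_induced]
    refine hSpi.tendsto_probabilityMeasure_of_tendsto_of_mem (μ := id) (ν := μ)
      (l := comap ev (𝓝 (ev μ))) hSm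
      (fun u hu x hx => ?_) fun s hs => ?_
    · obtain ⟨s, hs, hxs, hsu⟩ := hSb.exists_subset_of_mem_open hx hu
      exact ⟨s, hs, (hSb.isOpen hs).mem_nhds hxs, hsu⟩
    · exact ((continuous_apply (⟨s, hs⟩ : S)).tendsto (ev μ)).comp tendsto_comap
  refine (borel_anti hle).trans ?_
  rw [borel_comap, ← BorelSpace.measurable_eq (α := S → ℝ≥0)]
  refine Measurable.comap_le (measurable_pi_iff.2 fun s => ?_)
  exact ((Measure.measurable_coe (hSm s s.2)).comp measurable_subtype_coe).ennreal_toNNReal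

/-- The measurable structure carried by `ProbabilityMeasure K` is the Borel σ-algebra of the weak
topology. -/
instance borelSpace_probabilityMeasure (K : Type*) [TopologicalSpace K]
    [SecondCountableTopology K] [MeasurableSpace K] [BorelSpace K] [HasOuterApproxClosed K] :
    BorelSpace (ProbabilityMeasure K) :=
  ⟨le_antisymm (giry_le_borel K) (borel_le_giry K)⟩

theorem standardBorelSpace_unitInterval :
    StandardBorelSpace (ProbabilityMeasure unitInterval) := by
  have hp : PolishSpace (ProbabilityMeasure unitInterval) := by
    let _ := TopologicalSpace.metrizableSpaceMetric (ProbabilityMeasure unitInterval)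
    infer_instance
  infer_instance
theorem standardBorelSpace_of_measurableEmbedding {P Q : Type*} [MeasurableSpace P]
    [MeasurableSpace Q] [StandardBorelSpace Q] {f : P → Q} (hf : MeasurableEmbedding f) :
    StandardBorelSpace P := by
  have := hf.measurableSet_range.standardBorel
  obtain ⟨τ, hτ, hτ'⟩ := this
  let t : TopologicalSpace P := .induced hf.equivRange inferInstance
  have hp : PolishSpace P := hf.equivRange.toEquiv.polishSpace_induced
  have hb : BorelSpace P := by
    constructor
    exact hf.equivRange.measurableEmbedding.comap_eq.symm.trans
      ((congrArg (MeasurableSpace.comap _) (BorelSpace.measurable_eq (α := range f))).trans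
        borel_comap.symm)
  infer_instance

instance standardBorelSpace_probabilityMeasure (X : Type*) [MeasurableSpace X]
    [StandardBorelSpace X] : StandardBorelSpace (ProbabilityMeasure X) := by
  have := standardBorelSpace_unitInterval
  obtain ⟨e, he⟩ : ∃ e : X → unitInterval, MeasurableEmbedding e :=
    ⟨_, measurableEmbedding_sigmoid_comp_embeddingReal X⟩
  have hΦ : Measurable fun μ : ProbabilityMeasure X => μ.map he.measurable.aemeasurable :=
    ((Measure.measurable_map e he.measurable).comp measurable_subtype_coe).subtype_mk
  refine standardBorelSpace_of_measurableEmbedding (MeasurableEmbedding.iff_comap_eq.2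
    ⟨fun μ ν h => ?_, le_antisymm hΦ.comap_le ?_, ?_⟩)
  · apply Subtype.ext
    have := congrArg (fun ρ : ProbabilityMeasure unitInterval =>
      Measure.comap e (ρ : Measure unitInterval)) h
    simpa [he.comap_map] using this
  · let m : MeasurableSpace (ProbabilityMeasure X) := MeasurableSpace.comap
      (fun μ : ProbabilityMeasure X => μ.map he.measurable.aemeasurable) inferInstance
    have h : @Measurable _ _ m _ (fun μ : ProbabilityMeasure X => (μ : Measure X)) := by
      refine Measure.measurable_of_measurable_coe _ fun s hs => ?_
      have h1 : (fun μ : ProbabilityMeasure X => (μ : Measure X) s) =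
          (fun ν : ProbabilityMeasure unitInterval => (ν : Measure unitInterval) (e '' s)) ∘
            fun μ : ProbabilityMeasure X => μ.map he.measurable.aemeasurable := by
        funext μ
        simp [he.map_apply, he.injective.preimage_image]
      rw [h1]
      exact ((Measure.measurable_coe (he.measurableSet_image.2 hs)).comp
        measurable_subtype_coe).comp (comap_measurable _)
    exact (MeasurableSpace.comap_le_iff_le_map).2 h
  · have : range (fun μ : ProbabilityMeasure X => μ.map he.measurable.aemeasurable) =
        {ν : ProbabilityMeasure unitInterval | (ν : Measure unitInterval) (range e) = 1} := by
      ext ν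
      constructor
      · rintro ⟨μ, rfl⟩
        simp [Measure.map_apply he.measurable he.measurableSet_range]
      · intro hν
        refine ⟨⟨Measure.comap e ν, ⟨?_⟩⟩, Subtype.ext ?_⟩
        · simpa [he.comap_apply] using hν
        · change Measure.map e (Measure.comap e (ν : Measure unitInterval)) = ν
          rw [he.map_comap, Measure.restrict_eq_self_of_ae_mem]
          exact (prob_compl_eq_zero_iff he.measurableSet_range).2 hν
    rw [this]
    exact (Measure.measurable_coe he.measurableSet_range).comp measurable_subtype_coe
      (measurableSet_singleton 1)

section Definitions

variable {X Y : Type u} [MeasurableSpace X] [MeasurableSpace Y]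

/-! ### The universal type space

`X` is the player's own strategy space and `Y` the opponent's. -/

/-- The `n`-th order spaces of uncertainty together with their Borel σ-algebras. -/
def uncertaintyAux : ℕ → (X Y : Type u) → MeasurableSpace X → MeasurableSpace Y →
    (α : Type u) × MeasurableSpace α
  | 0, _, Y, _, mY => ⟨Y, mY⟩
  | n + 1, X, Y, mX, mY =>
    letI := (uncertaintyAux n X Y mX mY).2
    letI := (uncertaintyAux n Y X mY mX).2
    ⟨(uncertaintyAux n X Y mX mY).1 × ProbabilityMeasure (uncertaintyAux n Y X mY mX).1,
      inferInstance⟩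

/-- The `n`-th order space of uncertainty of a player with own strategies `X` facing an opponent
with strategies `Y`:
`Y × Δ(Uncertainty 0 Y X) × ⋯ × Δ(Uncertainty (n - 1) Y X)`. By definition
`Uncertainty 0 X Y = Y` and
`Uncertainty (n + 1) X Y = Uncertainty n X Y × Δ(Uncertainty n Y X)`. -/
def Uncertainty (n : ℕ) (X Y : Type u) [mX : MeasurableSpace X] [mY : MeasurableSpace Y] :
    Type u :=
  (uncertaintyAux n X Y mX mY).1

instance measurableSpace_uncertainty (n : ℕ) (X Y : Type u) [mX : MeasurableSpace X]
    [mY : MeasurableSpace Y] : MeasurableSpace (Uncertainty n X Y) :=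
  (uncertaintyAux n X Y mX mY).2

instance standardBorelSpace_uncertainty (n : ℕ) (X Y : Type u) [MeasurableSpace X]
    [MeasurableSpace Y] [StandardBorelSpace X] [StandardBorelSpace Y] :
    StandardBorelSpace (Uncertainty n X Y) := by
  induction n generalizing X Y with
  | zero => exact ‹StandardBorelSpace Y›
  | succ n ih =>
    have := ih X Y
    have := ih Y X
    exact (inferInstance :
      StandardBorelSpace (Uncertainty n X Y × ProbabilityMeasure (Uncertainty n Y X)))

/-- The projection forgetting the highest order belief of the opponent. -/
def Uncertainty.fst {n : ℕ} (u : Uncertainty (n + 1) X Y) : Uncertainty n X Y := Prod.fst u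

theorem Uncertainty.measurable_fst {n : ℕ} :
    Measurable (Uncertainty.fst : Uncertainty (n + 1) X Y → Uncertainty n X Y) :=
  _root_.measurable_fst

/-- Sequences of beliefs of all orders; `δ n` is the belief of order `n + 1`. -/
abbrev Hierarchy (X Y : Type u) [MeasurableSpace X] [MeasurableSpace Y] : Type u :=
  ∀ n : ℕ, ProbabilityMeasure (Uncertainty n X Y)

/-- Each belief is the marginal of the belief of the next order. -/
def Coherent (δ : Hierarchy X Y) : Prop :=
  ∀ n, (δ (n + 1)).map Uncertainty.measurable_fst.aemeasurable = δ n

/-- The first coordinates `(y, δ 0, …, δ (n - 1))` of a point `(y, δ)`. -/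
def truncate : (n : ℕ) → Y × Hierarchy Y X → Uncertainty n X Y
  | 0, p => p.1
  | n + 1, p => (truncate n p, p.2 n)

theorem measurable_truncate (n : ℕ) :
    Measurable (truncate n : Y × Hierarchy Y X → Uncertainty n X Y) := by
  induction n with
  | zero => exact _root_.measurable_fst
  | succ n ih => exact ih.prodMk ((measurable_pi_apply n).comp measurable_snd)

/-- The coordinate spaces of `Y × Hierarchy Y X`. -/
def Coord (X Y : Type u) [MeasurableSpace X] [MeasurableSpace Y] : ℕ → Type u
  | 0 => Y
  | n + 1 => ProbabilityMeasure (Uncertainty n Y X)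

instance measurableSpace_coord : (n : ℕ) → MeasurableSpace (Coord X Y n)
  | 0 => inferInstanceAs (MeasurableSpace Y)
  | n + 1 => inferInstanceAs (MeasurableSpace (ProbabilityMeasure (Uncertainty n Y X)))

/-- The finite sequences of coordinates, as points of the spaces of uncertainty. -/
def nest : (n : ℕ) → (Π i : Finset.Iic n, Coord X Y i) → Uncertainty n X Y
  | 0, x => x ⟨0, by simp⟩
  | n + 1, x => (nest n (Preorder.frestrictLe₂ n.le_succ x), x ⟨n + 1, by simp⟩)

theorem measurable_nest (n : ℕ) : Measurable (nest (X := X) (Y := Y) n) := by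
  induction n with
  | zero => exact measurable_pi_apply (⟨0, by simp⟩ : Finset.Iic 0)
  | succ n ih =>
    exact (ih.comp (Preorder.measurable_frestrictLe₂ n.le_succ)).prodMk
      (measurable_pi_apply (⟨n + 1, by simp⟩ : Finset.Iic (n + 1)))

/-- A sequence of coordinates, as a point of `Y × Hierarchy Y X`. -/
def assemble (x : ∀ n, Coord X Y n) : Y × Hierarchy Y X := (x 0, fun n => x (n + 1))

theorem measurable_assemble : Measurable (assemble (X := X) (Y := Y)) :=
  (measurable_pi_apply 0).prodMk (measurable_pi_lambda _ fun n => measurable_pi_apply (n + 1))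

theorem truncate_assemble (n : ℕ) (x : ∀ n, Coord X Y n) :
    truncate n (assemble x) = nest n (Preorder.frestrictLe n x) := by
  induction n with
  | zero => rfl
  | succ n ih => exact Prod.ext ih rfl

theorem map_compProd_comap {A B C : Type*} [MeasurableSpace A] [MeasurableSpace B]
    [MeasurableSpace C] (μ : Measure A) [IsFiniteMeasure μ] (κ : Kernel B C) [IsMarkovKernel κ]
    {f : A → B} (hf : Measurable f) :
    (μ ⊗ₘ κ.comap f hf).map (Prod.map f id) = μ.map f ⊗ₘ κ := by
  ext s hs
  rw [Measure.map_apply (hf.prodMap measurable_id) hs,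
    Measure.compProd_apply ((hf.prodMap measurable_id) hs), Measure.compProd_apply hs,
    lintegral_map (Kernel.measurable_kernel_prodMk_left hs) hf]
  rfl

/-- Kolmogorov extension of a coherent sequence of beliefs. -/
theorem exists_extension [StandardBorelSpace X] [StandardBorelSpace Y] (δ : Hierarchy X Y)
    (hδ : Coherent δ) : ∃ m : ProbabilityMeasure (Y × Hierarchy Y X),
      ∀ n, m.map (measurable_truncate n).aemeasurable = δ n := by
  have hne : ∀ n, Nonempty (ProbabilityMeasure (Uncertainty n Y X)) := fun n =>
    (δ (n + 1)).nonempty.map Prod.snd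
  let ρ : (n : ℕ) → Measure (Uncertainty n X Y × ProbabilityMeasure (Uncertainty n Y X)) :=
    fun n => (δ (n + 1) : Measure (Uncertainty (n + 1) X Y))
  have hρ : ∀ n, IsProbabilityMeasure (ρ n) := fun n =>
    inferInstanceAs (IsProbabilityMeasure (δ (n + 1) : Measure (Uncertainty (n + 1) X Y)))
  have hc : ∀ n, IsMarkovKernel (ρ n).condKernel := fun n => inferInstance
  let κ : (n : ℕ) → Kernel (Π i : Finset.Iic n, Coord X Y i) (Coord X Y (n + 1)) := fun n =>
    (ρ n).condKernel.comap (nest n) (measurable_nest n)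
  have hκ : ∀ n, IsMarkovKernel (κ n) := fun n =>
    inferInstanceAs (IsMarkovKernel ((ρ n).condKernel.comap (nest n) (measurable_nest n)))
  let μ₀ : Measure (Coord X Y 0) := (δ 0 : Measure (Uncertainty 0 X Y))
  have hμ₀ : IsProbabilityMeasure μ₀ :=
    inferInstanceAs (IsProbabilityMeasure (δ 0 : Measure (Uncertainty 0 X Y)))
  let P : Measure (∀ n, Coord X Y n) := Kernel.trajMeasure μ₀ κ
  have key : ∀ n, P.map (fun x => nest n (Preorder.frestrictLe n x)) =
      (δ n : Measure (Uncertainty n X Y)) := by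
    intro n
    induction n with
    | zero =>
      have h0 : P.map (Preorder.frestrictLe 0) =
          μ₀.map (MeasurableEquiv.piUnique fun i : Finset.Iic 0 => Coord X Y i).symm := by
        change ((Kernel.traj κ 0) ∘ₘ (μ₀.map (MeasurableEquiv.piUnique _).symm)).map _ = _
        rw [Measure.map_comp _ _ (Preorder.measurable_frestrictLe 0), Kernel.traj_map_frestrictLe,
          Kernel.partialTraj_self, Measure.id_comp]
        rfl
      have h1 := congrArg (Measure.map (nest (X := X) (Y := Y) 0)) h0
      rw [Measure.map_map (measurable_nest 0) (Preorder.measurable_frestrictLe 0)] at h1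
      refine h1.trans ((Measure.map_map (measurable_nest 0)
        (MeasurableEquiv.measurable _)).trans ?_)
      exact Measure.map_id (μ := μ₀)
    | succ n ih =>
      have h1 := Kernel.map_frestrictLe_trajMeasure_compProd_eq_map_trajMeasure
        (μ₀ := μ₀) (κ := κ) (a := n)
      have h2 : P.map (fun x => nest (n + 1) (Preorder.frestrictLe (n + 1) x)) =
          (P.map (fun x => (Preorder.frestrictLe n x, x (n + 1)))).map
            (Prod.map (nest n) id) :=
        (Measure.map_map ((measurable_nest n).prodMap measurable_id)
          ((Preorder.measurable_frestrictLe n).prodMk (measurable_pi_apply (n + 1)))).symm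
      have h3 : (P.map (Preorder.frestrictLe n)).map (nest n) = (ρ n).fst := by
        rw [Measure.map_map (measurable_nest n) (Preorder.measurable_frestrictLe n)]
        exact ih.trans (congrArg Subtype.val (hδ n)).symm
      refine h2.trans ?_
      rw [← h1]
      have h4 : (ρ n).fst ⊗ₘ (ρ n).condKernel = ρ n := (ρ n).disintegrate _
      refine Eq.trans ?_ h4
      rw [← h3]
      have := hc n
      exact map_compProd_comap (P.map (Preorder.frestrictLe n)) (ρ n).condKernel
        (measurable_nest n)
  have hP : IsProbabilityMeasure P := inferInstance
  refine ⟨⟨P.map assemble, Measure.isProbabilityMeasure_map measurable_assemble.aemeasurable⟩,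
    fun n => Subtype.ext ?_⟩
  change (P.map assemble).map (truncate n) = (δ n : Measure (Uncertainty n X Y))
  rw [Measure.map_map (measurable_truncate n) measurable_assemble, ← key n]
  congr 1
  funext x
  exact truncate_assemble n x

/-- A probability measure on `Y × Hierarchy Y X` is determined by its finite truncations. -/
theorem extension_unique (m m' : ProbabilityMeasure (Y × Hierarchy Y X))
    (h : ∀ n, m.map (measurable_truncate n).aemeasurable =
      m'.map (measurable_truncate n).aemeasurable) : m = m' := by
  let C : Set (Set (Y × Hierarchy Y X)) :=
    {t | ∃ (n : ℕ) (s : Set (Uncertainty n X Y)), MeasurableSet s ∧ truncate n ⁻¹' s = t}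
  have hmono : ∀ (n : ℕ) (s : Set (Uncertainty n X Y)), MeasurableSet s → ∀ N, n ≤ N →
      ∃ s' : Set (Uncertainty N X Y), MeasurableSet s' ∧
        (truncate N ⁻¹' s' : Set (Y × Hierarchy Y X)) = truncate n ⁻¹' s := by
    intro n s hs N hN
    induction N, hN using Nat.le_induction with
    | base => exact ⟨s, hs, rfl⟩
    | succ N _ ih =>
      obtain ⟨s', hs', he⟩ := ih
      exact ⟨Uncertainty.fst ⁻¹' s', Uncertainty.measurable_fst hs', he⟩
  have hpi : IsPiSystem C := by
    rintro _ ⟨n, s, hs, rfl⟩ _ ⟨k, t, ht, rfl⟩ -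
    obtain ⟨s', hs', he⟩ := hmono n s hs (max n k) (le_max_left _ _)
    obtain ⟨t', ht', he'⟩ := hmono k t ht (max n k) (le_max_right _ _)
    exact ⟨max n k, s' ∩ t', hs'.inter ht', by rw [preimage_inter, he, he']⟩
  have hgen : (inferInstance : MeasurableSpace (Y × Hierarchy Y X)) =
      MeasurableSpace.generateFrom C := by
    refine le_antisymm ?_ (MeasurableSpace.generateFrom_le ?_)
    · have h0 : Measurable[MeasurableSpace.generateFrom C]
          (Prod.fst : Y × Hierarchy Y X → Y) := fun s hs =>
        MeasurableSpace.measurableSet_generateFrom ⟨0, s, hs, rfl⟩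
      have h1 : ∀ n, Measurable[MeasurableSpace.generateFrom C]
          (fun p : Y × Hierarchy Y X => p.2 n) := fun n s hs =>
        MeasurableSpace.measurableSet_generateFrom
          ⟨n + 1, Prod.snd ⁻¹' s, measurable_snd hs, rfl⟩
      have h2 : Measurable[MeasurableSpace.generateFrom C]
          (Prod.snd : Y × Hierarchy Y X → Hierarchy Y X) :=
        @measurable_pi_lambda _ _ _ (MeasurableSpace.generateFrom C) _ _ h1
      exact sup_le h0.comap_le h2.comap_le
    · rintro _ ⟨n, s, hs, rfl⟩
      exact measurable_truncate n hs
  refine ProbabilityMeasure.toMeasure_injective (ext_of_generate_finite C hgen hpi ?_ ?_)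
  · rintro _ ⟨n, s, hs, rfl⟩
    have := congrArg (fun ρ : ProbabilityMeasure (Uncertainty n X Y) =>
      (ρ : Measure (Uncertainty n X Y)) s) (h n)
    simpa [Measure.map_apply (measurable_truncate n) hs] using this
  · exact (measure_univ (μ := (m : Measure (Y × Hierarchy Y X)))).trans
      (measure_univ (μ := (m' : Measure (Y × Hierarchy Y X)))).symm

/-- The measure on `Y × Hierarchy Y X` determined by a coherent sequence of beliefs. -/
noncomputable def extension [StandardBorelSpace X] [StandardBorelSpace Y] (δ : Hierarchy X Y)
    (hδ : Coherent δ) : ProbabilityMeasure (Y × Hierarchy Y X) :=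
  (exists_extension δ hδ).choose

theorem map_extension [StandardBorelSpace X] [StandardBorelSpace Y] (δ : Hierarchy X Y)
    (hδ : Coherent δ) (n : ℕ) :
    (extension δ hδ).map (measurable_truncate n).aemeasurable = δ n :=
  (exists_extension δ hδ).choose_spec n

/-- Level `0` consists of the coherent sequences of beliefs; level `k + 1` of the coherent
sequences that are certain that the opponent's sequence is in level `k`. -/
def typeLevel : ℕ → ∀ (X Y : Type u) [MeasurableSpace X] [MeasurableSpace Y]
    [StandardBorelSpace X] [StandardBorelSpace Y], Set (Hierarchy X Y)
  | 0, _, _, _, _, _, _ => {δ | Coherent δ}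
  | k + 1, X, Y, _, _, _, _ =>
    {δ | ∃ hδ : Coherent δ,
      ∀ᵐ p ∂(extension δ hδ : Measure (Y × Hierarchy Y X)), p.2 ∈ typeLevel k Y X}

/-- The universal type space: the sequences of beliefs with common certainty of coherency. -/
def UType (X Y : Type u) [MeasurableSpace X] [MeasurableSpace Y] [StandardBorelSpace X]
    [StandardBorelSpace Y] : Type u :=
  {δ : Hierarchy X Y // ∀ k, δ ∈ typeLevel k X Y}

section Beliefs

variable [StandardBorelSpace X] [StandardBorelSpace Y]

instance measurableSpace_uType : MeasurableSpace (UType X Y) :=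
  inferInstanceAs (MeasurableSpace {δ : Hierarchy X Y // ∀ k, δ ∈ typeLevel k X Y})

theorem UType.coherent (t : UType X Y) : Coherent t.1 := t.2 0

/-- The inclusion of `Y × UType Y X` into `Y × Hierarchy Y X`. -/
def inclusion (p : Y × UType Y X) : Y × Hierarchy Y X := (p.1, p.2.1)

theorem measurable_inclusion : Measurable (inclusion : Y × UType Y X → Y × Hierarchy Y X) :=
  measurable_fst.prodMk (measurable_subtype_coe.comp measurable_snd)

theorem inclusion_injective :
    Function.Injective (inclusion : Y × UType Y X → Y × Hierarchy Y X) := by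
  rintro ⟨y, s⟩ ⟨y', s'⟩ h
  obtain ⟨h1, h2⟩ := Prod.mk.inj h
  exact Prod.ext h1 (Subtype.ext h2)

theorem ae_mem_range_inclusion (t : UType X Y) :
    ∀ᵐ p ∂(extension t.1 t.coherent : Measure (Y × Hierarchy Y X)),
      p ∈ range (inclusion : Y × UType Y X → Y × Hierarchy Y X) := by
  have h : ∀ᵐ p ∂(extension t.1 t.coherent : Measure (Y × Hierarchy Y X)),
      ∀ k, p.2 ∈ typeLevel k Y X := ae_all_iff.2 fun k => (t.2 (k + 1)).2
  filter_upwards [h] with p hp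
  exact ⟨(p.1, ⟨p.2, hp⟩), rfl⟩

theorem nullMeasurableSet_of_ae_mem {α : Type*} [MeasurableSpace α] {μ : Measure α} {s : Set α}
    (h : ∀ᵐ x ∂μ, x ∈ s) : NullMeasurableSet s μ :=
  nullMeasurableSet_univ.congr (by
    filter_upwards [h] with x hx using propext ⟨fun _ => hx, fun _ => trivial⟩)

theorem nullMeasurableSet_image_inclusion (t : UType X Y) (s : Set (Y × UType Y X))
    (hs : MeasurableSet s) : NullMeasurableSet (inclusion '' s)
      (extension t.1 t.coherent : Measure (Y × Hierarchy Y X)) := by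
  have hle : (inferInstance : MeasurableSpace (Y × UType Y X)) ≤
      MeasurableSpace.comap inclusion inferInstance := by
    have h : Measurable[MeasurableSpace.comap inclusion inferInstance]
        (inclusion : Y × UType Y X → Y × Hierarchy Y X) := comap_measurable _
    have h1 : Measurable[MeasurableSpace.comap inclusion inferInstance]
        (Prod.fst : Y × UType Y X → Y) :=
      fun u hu => h (measurable_fst hu)
    have h2 : Measurable[MeasurableSpace.comap inclusion inferInstance]
        (Prod.snd : Y × UType Y X → UType Y X) :=
      fun u ⟨v, hv, hvu⟩ => hvu ▸ h (measurable_snd hv)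
    exact sup_le h1.comap_le h2.comap_le
  obtain ⟨s', hs', rfl⟩ := hle s hs
  rw [image_preimage_eq_inter_range]
  exact hs'.nullMeasurableSet.inter (nullMeasurableSet_of_ae_mem (ae_mem_range_inclusion t))

/-- The belief of a type about the opponent's strategy and type: its extension, regarded as a
measure on `Y × UType Y X`. -/
noncomputable def belief (t : UType X Y) : ProbabilityMeasure (Y × UType Y X) :=
  ⟨Measure.comap inclusion (extension t.1 t.coherent : Measure (Y × Hierarchy Y X)), ⟨by
    rw [Measure.comap_apply₀ _ _ inclusion_injective (nullMeasurableSet_image_inclusion t)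
      nullMeasurableSet_univ, image_univ]
    exact mem_ae_iff_prob_eq_one₀ (nullMeasurableSet_of_ae_mem (ae_mem_range_inclusion t)) |>.1
      (ae_mem_range_inclusion t)⟩⟩

theorem map_belief (t : UType X Y) :
    (belief t).map measurable_inclusion.aemeasurable = extension t.1 t.coherent := by
  refine Subtype.ext (Measure.ext fun s hs => ?_)
  change ((Measure.comap inclusion (extension t.1 t.coherent : Measure (Y × Hierarchy Y X))).map
    inclusion) s = _
  rw [Measure.map_apply measurable_inclusion hs, Measure.comap_preimage _ _ inclusion_injective
    measurable_inclusion (nullMeasurableSet_image_inclusion t) hs]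
  refine measure_congr ?_
  filter_upwards [ae_mem_range_inclusion t] with x hx
  exact propext ⟨fun h => h.1, fun h => ⟨h, hx⟩⟩

/-- The marginal on the opponent's strategies of the belief of a type. -/
noncomputable def firstOrderBelief (t : UType X Y) : ProbabilityMeasure Y :=
  (belief t).map measurable_fst.aemeasurable

end Beliefs

/-! ### Interactive epistemics

A relation between strategies and beliefs of a player with strategies `X` facing an opponent with
strategies `Y` is a set `E` of pairs in `X × Δ(Y)`. The condition `μ(B) = 1`, in the sense of the
completion of `μ`, is written `∀ᵐ y ∂μ, y ∈ B`. -/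

/-- A set is universally measurable if it is measurable for the completion of every Borel
probability measure. -/
def UniversallyMeasurableSet {α : Type*} [MeasurableSpace α] (s : Set α) : Prop :=
  ∀ μ : ProbabilityMeasure α, NullMeasurableSet s (μ : Measure α)

/-- A function is universally measurable if preimages of Borel sets are. -/
def UniversallyMeasurable {α β : Type*} [MeasurableSpace α] [MeasurableSpace β] (f : α → β) :
    Prop :=
  ∀ s, MeasurableSet s → UniversallyMeasurableSet (f ⁻¹' s)

/-- Every strategy in `A` is `E`-related to a belief that concentrates on `B`. -/
def JustifiedBy (E : Set (X × ProbabilityMeasure Y)) (A : Set X) (B : Set Y) : Prop :=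
  ∀ s ∈ A, ∃ μ : ProbabilityMeasure Y, (s, μ) ∈ E ∧ ∀ᵐ y ∂(μ : Measure Y), y ∈ B

/-- The `E`-rationalizable strategies of the player with relation `E`, where `F` is the relation
of the opponent: the union of the sides of the justified rectangles. -/
def rat (E : Set (X × ProbabilityMeasure Y)) (F : Set (Y × ProbabilityMeasure X)) : Set X :=
  {s | ∃ (A : Set X) (B : Set Y), JustifiedBy E A B ∧ JustifiedBy F B A ∧ s ∈ A}

/-- The rectangle of the rationalizable strategies of both players. -/
def RAT (E : Set (X × ProbabilityMeasure Y)) (F : Set (Y × ProbabilityMeasure X)) :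
    Set (X × Y) :=
  rat E F ×ˢ rat F E

/-- The stages of the transfinite deletion of the unjustified strategies of both players. -/
noncomputable def stage (E : Set (X × ProbabilityMeasure Y)) (F : Set (Y × ProbabilityMeasure X))
    (α : Ordinal.{u}) : Set X × Set Y :=
  Ordinal.limitRecOn α (univ, univ)
    (fun _ S =>
      ({s | s ∈ S.1 ∧ ∃ μ : ProbabilityMeasure Y, (s, μ) ∈ E ∧ ∀ᵐ y ∂(μ : Measure Y), y ∈ S.2},
       {s | s ∈ S.2 ∧ ∃ μ : ProbabilityMeasure X, (s, μ) ∈ F ∧ ∀ᵐ x ∂(μ : Measure X), x ∈ S.1}))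
    (fun α _ S => (⋂ (β : Ordinal.{u}) (h : β < α), (S β h).1,
      ⋂ (β : Ordinal.{u}) (h : β < α), (S β h).2))

/-- `rcbrLevel n` is the set of pairs of a strategy and a type at which `E` and `n`-fold mutual
belief in it hold. -/
def rcbrLevel : ℕ → ∀ (X Y : Type u) [MeasurableSpace X] [MeasurableSpace Y]
    [StandardBorelSpace X] [StandardBorelSpace Y],
    Set (X × ProbabilityMeasure Y) → Set (Y × ProbabilityMeasure X) → Set (X × UType X Y)
  | 0, _, _, _, _, _, _, E, _ => {p | (p.1, firstOrderBelief p.2) ∈ E}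
  | n + 1, X, Y, _, _, _, _, E, F =>
    {p | p ∈ rcbrLevel n X Y E F ∧
      ∀ᵐ q ∂(belief p.2 : Measure (Y × UType Y X)), q ∈ rcbrLevel n Y X F E}

/-- The strategies of the player with relation `E` which are consistent with `E` and common belief
in `E`, where `F` is the relation of the opponent. -/
def rcbr [StandardBorelSpace X] [StandardBorelSpace Y] (E : Set (X × ProbabilityMeasure Y))
    (F : Set (Y × ProbabilityMeasure X)) : Set X :=
  {s | ∃ t : UType X Y, ∀ n, (s, t) ∈ rcbrLevel n X Y E F}

/-- The rectangle of the strategies of both players consistent with common belief. -/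
def RCBR [StandardBorelSpace X] [StandardBorelSpace Y] (E : Set (X × ProbabilityMeasure Y))
    (F : Set (Y × ProbabilityMeasure X)) : Set (X × Y) :=
  rcbr E F ×ˢ rcbr F E

/-! ### Games -/

/-- A two-person strategic form game with strategy spaces `X₁` and `X₂`, with bounded universally
measurable payoffs. -/
structure Game (X₁ X₂ : Type u) [MeasurableSpace X₁] [MeasurableSpace X₂] where
  /-- The payoff of the first player. -/
  payoff₁ : X₁ → X₂ → ℝ
  /-- The payoff of the second player. -/
  payoff₂ : X₁ → X₂ → ℝ
  bounded₁ : ∃ C, ∀ x y, |payoff₁ x y| ≤ C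
  bounded₂ : ∃ C, ∀ x y, |payoff₂ x y| ≤ C
  measurable₁ : UniversallyMeasurable fun p : X₁ × X₂ => payoff₁ p.1 p.2
  measurable₂ : UniversallyMeasurable fun p : X₁ × X₂ => payoff₂ p.1 p.2

namespace Game

variable (G : Game X Y)

/-- The best response relation of the first player. -/
def bestResponse₁ : Set (X × ProbabilityMeasure Y) :=
  {p | ∀ x, ∫ y, G.payoff₁ x y ∂(p.2 : Measure Y) ≤ ∫ y, G.payoff₁ p.1 y ∂(p.2 : Measure Y)}

/-- The best response relation of the second player. -/
def bestResponse₂ : Set (Y × ProbabilityMeasure X) :=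
  {p | ∀ y, ∫ x, G.payoff₂ x y ∂(p.2 : Measure X) ≤ ∫ x, G.payoff₂ x p.1 ∂(p.2 : Measure X)}

/-- The rationalizable strategies of the first player: those that survive every stage of the
iterated deletion of never-best-responses. -/
def rationalizable₁ : Set X :=
  {s | ∀ α : Ordinal.{u}, s ∈ (stage G.bestResponse₁ G.bestResponse₂ α).1}

/-- The rationalizable strategies of the second player. -/
def rationalizable₂ : Set Y :=
  {s | ∀ α : Ordinal.{u}, s ∈ (stage G.bestResponse₁ G.bestResponse₂ α).2}

/-- The strategies of the first player consistent with rationality and common belief in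
rationality. -/
def rcbr₁ [StandardBorelSpace X] [StandardBorelSpace Y] : Set X :=
  rcbr G.bestResponse₁ G.bestResponse₂

/-- The strategies of the second player consistent with rationality and common belief in
rationality. -/
def rcbr₂ [StandardBorelSpace X] [StandardBorelSpace Y] : Set Y :=
  rcbr G.bestResponse₂ G.bestResponse₁

end Game

end Definitions

end Epistemic

namespace Epistemic

/-! ### Functions that meet null sets in all but countably many points -/

/-! The Continuum Hypothesis supplies a Luzin-type function `f`: for every finite measure, some null
set contains all but countably many of its values, counted by argument. Hence the graph of `f`, and
even the graph of `x ↦ δ_{f x}` inside `X × Δ(Y)`, is a null set together with a countable set with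
respect to any given probability measure. Such a graph is universally measurable, yet it carries no
measure whose marginal on `X` is diffuse (`NullValued.graph_diracProba`,
`NullValued.not_ae_diracProba`).

This separates the two solution concepts. Suppose that a strategy `s` is justified only by a diffuse
belief `l`, and that `l`-almost every opponent strategy `y` is justified only by `δ_{f y}`.
Rationalizability asks for one belief per strategy, with no measurability in the strategy, so it
retains everything. A type of `s` with common belief would instead hold a joint belief on opponent
strategies and first-order beliefs, concentrated on the graph and with marginal `l`; there is none
(`not_mem_rcbr`).

For the second claim the relations can be prescribed directly: one player is always related to `l`,
the other to the unit masses. For the first they must come from payoffs. A strategy in `M` guesses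
the single point `f s`, the strategy `z` guesses the set `M`, and the strategies in `T` are bets at
prices given by `l`. The null bet secures payoff 1, so a guess is optimal only if it is certain to
be right; the other bets then rule out every belief of `z` except `l`. Each strategy is a best
response to something, so no deletion ever takes place. -/

/-- A finite measure has only countably many atoms, so a countable dense set can avoid them all and
is null. Open neighbourhoods of it with measure tending to zero intersect in a dense Gδ null set. -/
theorem exists_residual_null (ν : Measure ℝ) [IsFiniteMeasure ν] :
    ∃ G ∈ residual ℝ, MeasurableSet G ∧ ν G = 0 := by
  have hA : {t : ℝ | 0 < ν {a | a = t}}.Countable :=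
    Measure.countable_meas_level_set_pos measurable_id
  obtain ⟨D, hDA, hDc, hDd⟩ := (hA.dense_compl ℝ).exists_countable_dense_subset
  have hD0 : ν D = 0 := by
    rw [← biUnion_of_singleton D, measure_biUnion_null_iff hDc]
    exact fun t ht => nonpos_iff_eq_zero.1 (not_lt.1 (hDA ht))
  have hU : ∀ n : ℕ, ∃ U, D ⊆ U ∧ IsOpen U ∧ ν U < ((n : ENNReal) + 1)⁻¹ := fun n =>
    D.exists_isOpen_lt_of_lt _ (by simp [hD0])
  choose U hDU hUo hU using hU
  have hG : IsGδ (⋂ n, U n) := .iInter_of_isOpen hUo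
  refine ⟨⋂ n, U n, residual_of_dense_Gδ hG (hDd.mono (subset_iInter hDU)),
    hG.measurableSet, ?_⟩
  refine le_antisymm (ge_of_tendsto' ENNReal.tendsto_inv_nat_nhds_zero fun n => ?_) zero_le
  refine (measure_mono (iInter_subset U n)).trans ((hU n).le.trans ?_)
  exact ENNReal.inv_le_inv.2 le_self_add

/-- `f` maps all but countably many points of `M` into some null set of any given finite
measure. Under the continuum hypothesis, a countable-to-one function onto a Luzin set has this
property. -/
def NullValued {A Y : Type*} [MeasurableSpace Y] (f : A → Y) (M : Set A) : Prop :=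
  ∀ ν : Measure Y, IsFiniteMeasure ν →
    ∃ G, MeasurableSet G ∧ ν G = 0 ∧ {x ∈ M | f x ∉ G}.Countable

theorem exists_nullValued_real (CH : Cardinal.continuum.{0} = Cardinal.aleph.{0} 1) :
    ∃ f : ℝ → ℝ, NullValued f univ := by
  -- The relation behaves like a well-order of type continuum: each point has few predecessors, and
  -- each point precedes all but few others. Under CH, few means countably many.
  obtain ⟨r, hr, hr'⟩ := Cardinal.exists_rel_mk_fibers_lt ℝ
  simp only [Cardinal.mk_real, CH, ← Cardinal.succ_aleph0, Order.lt_succ_iff,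
    Cardinal.mk_le_aleph0_iff] at hr hr'
  choose G hGr hGm hG0 using fun ν : ProbabilityMeasure ℝ => exists_residual_null (ν : Measure ℝ)
  obtain ⟨i, hi⟩ := exists_measurableEmbedding_real (ProbabilityMeasure ℝ)
  -- Measures are coded by reals, and `f x` must lie in the residual null sets of the countably many
  -- measures that precede `x`; Baire's theorem leaves room for it.
  have hne : ∀ x, (⋂ ν ∈ {ν | r (i ν) x}, G ν).Nonempty := fun x =>
    (dense_of_mem_residual ((countable_bInter_mem
      ((countable_coe_iff.1 (hr' x)).preimage hi.injective)).2
        fun ν _ => hGr ν)).nonempty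
  choose f hf using hne
  refine ⟨f, fun ν _ => ?_⟩
  rcases eq_or_ne ν 0 with rfl | hν
  · exact ⟨univ, .univ, rfl, by simp⟩
  have : NeZero ν := ⟨hν⟩
  let ρ : ProbabilityMeasure ℝ := ⟨(ν univ)⁻¹ • ν, inferInstance⟩
  refine ⟨G ρ, hGm ρ, ?_, (countable_coe_iff.1 (hr (i ρ))).mono fun x hx => ?_⟩
  · have h : ((ν univ)⁻¹ • ν) (G ρ) = 0 := hG0 ρ
    simpa [measure_ne_top] using h
  · exact fun h => hx.2 (mem_iInter₂.1 (hf x) ρ h)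

/-- The null set is found for the pulled-back measure and pushed forward by `j`; injectivity of `i`
keeps the exceptional set countable. -/
theorem NullValued.comp {A B Y Z : Type*} [MeasurableSpace Y] [MeasurableSpace Z] {f : B → Y}
    (hf : NullValued f univ) {i : A → B} (hi : Function.Injective i) {j : Y → Z}
    (hj : MeasurableEmbedding j) (M : Set A) : NullValued (j ∘ f ∘ i) M := by
  intro ν _
  obtain ⟨G, hGm, hG0, hGc⟩ := hf (ν.comap j) inferInstance
  refine ⟨j '' G, hj.measurableSet_image.2 hGm, by rwa [← hj.comap_apply],
    (hGc.preimage hi).mono fun x hx => ?_⟩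
  exact ⟨mem_univ _, fun h => hx.2 ⟨_, h, rfl⟩⟩

theorem exists_nullValued (CH : Cardinal.continuum.{0} = Cardinal.aleph.{0} 1) {A Z : Type*}
    [MeasurableSpace A] [StandardBorelSpace A] [MeasurableSpace Z] {j : ℝ → Z}
    (hj : MeasurableEmbedding j) (M : Set A) :
    ∃ f : A → Z, range f ⊆ range j ∧ NullValued f M := by
  obtain ⟨f, hf⟩ := exists_nullValued_real CH
  obtain ⟨i, hi⟩ := exists_measurableEmbedding_real A
  exact ⟨j ∘ f ∘ i, range_comp_subset_range _ _, hf.comp hi.injective hj M⟩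

theorem universallyMeasurableSet_of_null_countable {α : Type*} [MeasurableSpace α]
    [MeasurableSingletonClass α] {s : Set α}
    (h : ∀ μ : ProbabilityMeasure α, ∃ N, (μ : Measure α) N = 0 ∧ (s \ N).Countable) :
    UniversallyMeasurableSet s := fun μ => by
  obtain ⟨N, hN, hc⟩ := h μ
  rw [← inter_union_sdiff s N]
  exact (NullMeasurableSet.of_null (measure_mono_null inter_subset_right hN)).union
    hc.measurableSet.nullMeasurableSet

theorem countable_graph_sdiff {X Z : Type*} {M : Set X} {g : X → Z} {N : Set (X × Z)}
    (h : {x ∈ M | (x, g x) ∉ N}.Countable) : ({p | p.1 ∈ M ∧ p.2 = g p.1} \ N).Countable :=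
  (h.image fun x => (x, g x)).mono <| by
    rintro ⟨x, z⟩ ⟨⟨hM, hz⟩, hN⟩
    obtain rfl : z = g x := hz
    exact ⟨x, ⟨hM, hN⟩, rfl⟩

/-! ### Graphs of null-valued functions -/

section

variable {X Y : Type*} [MeasurableSpace X] [MeasurableSpace Y] {f : X → Y} {M : Set X}

theorem NullValued.graph [MeasurableSingletonClass X] [MeasurableSingletonClass Y]
    (hf : NullValued f M) : UniversallyMeasurableSet {p : X × Y | p.1 ∈ M ∧ p.2 = f p.1} := by
  refine universallyMeasurableSet_of_null_countable fun μ => ?_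
  obtain ⟨G, hGm, hG0, hGc⟩ := hf ((μ : Measure (X × Y)).map Prod.snd) inferInstance
  rw [Measure.map_apply measurable_snd hGm] at hG0
  exact ⟨Prod.snd ⁻¹' G, hG0, countable_graph_sdiff hGc⟩

/-- The graph of `x ↦ δ (f x)` on `M` is countable off a null set of any given probability
measure. -/
theorem NullValued.exists_null_diracProba (hf : NullValued f M)
    (ρ : ProbabilityMeasure (X × ProbabilityMeasure Y)) :
    ∃ N, (ρ : Measure (X × ProbabilityMeasure Y)) N = 0 ∧
      ({p : X × ProbabilityMeasure Y | p.1 ∈ M ∧ p.2 = diracProba (f p.1)} \ N).Countable := by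
  let g : X × ProbabilityMeasure Y → Measure Y := fun p => p.2
  have hg : Measurable g := measurable_subtype_coe.comp measurable_snd
  -- The barycentre of the random measure `p.2` under `ρ`: a set null for it is null for `ρ`-almost
  -- every `p.2`.
  let ν : Measure Y := ((ρ : Measure (X × ProbabilityMeasure Y)).map g).join
  have hν : ∀ s, MeasurableSet s →
      ν s = ∫⁻ p, g p s ∂(ρ : Measure (X × ProbabilityMeasure Y)) := fun s hs => by
    rw [Measure.join_apply hs, lintegral_map (Measure.measurable_coe hs) hg]
  have hν1 : IsFiniteMeasure ν := ⟨by rw [hν _ .univ]; simp [g]⟩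
  obtain ⟨G, hGm, hG0, hGc⟩ := hf ν hν1
  have hGg : Measurable fun p => g p G := (Measure.measurable_coe hGm).comp hg
  rw [hν _ hGm, lintegral_eq_zero_iff hGg] at hG0
  -- The beliefs that charge `G` form the null set. If `f x ∈ G`, then `δ_{f x}` gives `G` mass one,
  -- so the graph leaves this set only over the countably many exceptional `x`.
  refine ⟨{p | g p G ≠ 0}, hG0,
    countable_graph_sdiff (g := fun x => diracProba (f x)) (hGc.mono fun x hx => ?_)⟩
  refine ⟨hx.1, fun h => hx.2 ?_⟩
  simp [g, diracProba, Measure.dirac_apply' _ hGm, h]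

theorem NullValued.graph_diracProba [MeasurableSingletonClass X] [StandardBorelSpace Y]
    (hf : NullValued f M) :
    UniversallyMeasurableSet
      {p : X × ProbabilityMeasure Y | p.1 ∈ M ∧ p.2 = diracProba (f p.1)} :=
  universallyMeasurableSet_of_null_countable hf.exists_null_diracProba

/-- The graph of `x ↦ δ (f x)` on `M` does not carry any measure with a diffuse marginal. -/
theorem NullValued.not_ae_diracProba (hf : NullValued f M)
    (ρ : ProbabilityMeasure (X × ProbabilityMeasure Y))
    (hρ : NullSingletonClass ((ρ : Measure (X × ProbabilityMeasure Y)).map Prod.fst)) :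
    ¬ ∀ᵐ p ∂(ρ : Measure (X × ProbabilityMeasure Y)),
      p.1 ∈ M ∧ p.2 = diracProba (f p.1) := by
  intro h
  obtain ⟨N, hN, hc⟩ := hf.exists_null_diracProba ρ
  have h0 := (hc.image Prod.fst).measure_zero
    ((ρ : Measure (X × ProbabilityMeasure Y)).map Prod.fst)
  have h1 := ae_of_ae_map measurable_fst.aemeasurable
    (show ∀ᵐ x ∂((ρ : Measure (X × ProbabilityMeasure Y)).map Prod.fst), x ∉ _ from
      measure_eq_zero_iff_ae_notMem.1 h0)
  have h2 : ∀ᵐ p ∂(ρ : Measure (X × ProbabilityMeasure Y)), False := by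
    filter_upwards [h, measure_eq_zero_iff_ae_notMem.1 hN, h1] with p hp hpN hp1
    exact hp1 ⟨p, ⟨hp, hpN⟩, rfl⟩
  exact IsProbabilityMeasure.ne_zero (ρ : Measure (X × ProbabilityMeasure Y)) (by simpa using h2)

end

/-! ### The obstruction to common belief -/

section

variable {X Y : Type u} [MeasurableSpace X] [MeasurableSpace Y] [StandardBorelSpace X]
  [StandardBorelSpace Y]

theorem firstOrderBelief_eq (t : UType X Y) : firstOrderBelief t = t.1 0 := by
  rw [← map_extension t.1 t.coherent 0, ← map_belief t]
  exact Subtype.ext (Measure.map_map (measurable_truncate 0) measurable_inclusion).symm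

theorem measurable_firstOrderBelief :
    Measurable (firstOrderBelief : UType X Y → ProbabilityMeasure Y) := by
  rw [funext firstOrderBelief_eq]
  exact (measurable_pi_apply 0).comp measurable_subtype_coe

/-- A strategy that is related to a diffuse belief only is inconsistent with common belief if the
opponent's strategies in the support of that belief are only related to the unit masses at the
values of a `NullValued` function. -/
theorem not_mem_rcbr {E : Set (X × ProbabilityMeasure Y)} {F : Set (Y × ProbabilityMeasure X)}
    {f : Y → X} {M : Set Y} (hf : NullValued f M) {l : ProbabilityMeasure Y}
    (hl : NullSingletonClass (l : Measure Y)) (hlM : ∀ᵐ y ∂(l : Measure Y), y ∈ M) {s : X}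
    (hE : ∀ μ, (s, μ) ∈ E → μ = l)
    (hF : ∀ y ∈ M, ∀ μ, (y, μ) ∈ F → μ = diracProba (f y)) : s ∉ rcbr E F := by
  rintro ⟨t, ht⟩
  have hm : Measurable fun q : Y × UType Y X => (q.1, firstOrderBelief q.2) :=
    measurable_fst.prodMk (measurable_firstOrderBelief.comp measurable_snd)
  have hl' : (belief t : Measure (Y × UType Y X)).map Prod.fst = l :=
    congrArg Subtype.val (hE _ (ht 0))
  have hlM' := ae_of_ae_map measurable_fst.aemeasurable (hl' ▸ hlM)
  obtain ⟨s₀, hs₀⟩ : ∃ s₀ : Set (Y × ProbabilityMeasure X), s₀ =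
    {p | p.1 ∈ M ∧ p.2 = diracProba (f p.1)} := ⟨_, rfl⟩
  have hs₀' : NullMeasurableSet s₀ ((belief t : Measure (Y × UType Y X)).map
      fun q => (q.1, firstOrderBelief q.2)) := by
    rw [hs₀]
    exact hf.graph_diracProba ((belief t).map hm.aemeasurable)
  refine hf.not_ae_diracProba ((belief t).map hm.aemeasurable) ?_ ?_
  · change NullSingletonClass (((belief t : Measure (Y × UType Y X)).map _).map Prod.fst)
    rw [Measure.map_map measurable_fst hm]
    change NullSingletonClass ((belief t : Measure (Y × UType Y X)).map Prod.fst)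
    rwa [hl']
  · have h : ∀ᵐ q ∂(belief t : Measure (Y × UType Y X)), (q.1, firstOrderBelief q.2) ∈ s₀ := by
      filter_upwards [hlM', (ht 1).2] with q hq hq'
      rw [hs₀]
      exact ⟨hq, hF _ hq _ hq'⟩
    have h' : ∀ᵐ p ∂((belief t).map hm.aemeasurable : Measure (Y × ProbabilityMeasure X)),
        p ∈ s₀ :=
      -- Universal measurability of the graph is what lets full measure pass to the image measure.
      (Measure.map_apply₀ hm.aemeasurable hs₀'.compl).trans h
    rwa [hs₀] at h'

end

/-! ### Rationalizability when every strategy is justified -/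

theorem rat_eq_univ {X Y : Type u} [MeasurableSpace X] [MeasurableSpace Y]
    {E : Set (X × ProbabilityMeasure Y)} {F : Set (Y × ProbabilityMeasure X)}
    (hE : ∀ s, ∃ μ, (s, μ) ∈ E) (hF : ∀ s, ∃ μ, (s, μ) ∈ F) : rat E F = univ :=
  eq_univ_of_forall fun s => ⟨univ, univ, fun s _ => (hE s).imp fun _ h => ⟨h, by simp⟩,
    fun s _ => (hF s).imp fun _ h => ⟨h, by simp⟩, mem_univ s⟩

theorem stage_eq_univ {X Y : Type u} [MeasurableSpace X] [MeasurableSpace Y]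
    {E : Set (X × ProbabilityMeasure Y)} {F : Set (Y × ProbabilityMeasure X)}
    (hE : ∀ s, ∃ μ, (s, μ) ∈ E) (hF : ∀ s, ∃ μ, (s, μ) ∈ F) (α : Ordinal.{u}) :
    stage E F α = (univ, univ) := by
  induction α using Ordinal.limitRecOn with
  | zero => exact Ordinal.limitRecOn_zero ..
  | add_one α ih =>
    refine (Ordinal.limitRecOn_add_one ..).trans ?_
    change (({s | s ∈ (stage E F α).1 ∧ ∃ μ : ProbabilityMeasure Y, (s, μ) ∈ E ∧
        ∀ᵐ y ∂(μ : Measure Y), y ∈ (stage E F α).2}, {s | s ∈ (stage E F α).2 ∧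
        ∃ μ : ProbabilityMeasure X, (s, μ) ∈ F ∧
        ∀ᵐ x ∂(μ : Measure X), x ∈ (stage E F α).1}) : Set X × Set Y) = _
    rw [ih]
    simp [hE, hF]
  | limit α hα ih =>
    refine (Ordinal.limitRecOn_limit _ _ _ _ hα).trans ?_
    change ((⋂ (β : Ordinal.{u}) (_ : β < α), (stage E F β).1,
      ⋂ (β : Ordinal.{u}) (_ : β < α), (stage E F β).2) : Set X × Set Y) = _
    refine Prod.ext ?_ ?_
    · exact eq_univ_of_forall fun x => mem_iInter₂.2 fun β hβ => by rw [ih β hβ]; trivial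
    · exact eq_univ_of_forall fun x => mem_iInter₂.2 fun β hβ => by rw [ih β hβ]; trivial

/-! ### Relations on perfect Polish spaces -/

/-- A measurable copy of the real line carries a diffuse probability measure. -/
theorem exists_diffuse {Y : Type*} [MeasurableSpace Y] {j : ℝ → Y} (hj : MeasurableEmbedding j) :
    ∃ l : ProbabilityMeasure Y, NullSingletonClass (l : Measure Y) ∧ ∀ᵐ y ∂(l : Measure Y), y ∈ range j := by
  have h1 : IsProbabilityMeasure (volume.restrict (Icc (0 : ℝ) 1)) := ⟨by simp⟩
  refine ⟨⟨(volume.restrict (Icc (0 : ℝ) 1)).map j,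
    Measure.isProbabilityMeasure_map hj.measurable.aemeasurable⟩, ⟨fun y => ?_⟩, ?_⟩
  · change (Measure.map j _) _ = 0
    rw [hj.map_apply]
    exact (subsingleton_singleton.preimage hj.injective).measure_zero _
  · exact (ae_map_iff hj.measurable.aemeasurable hj.measurableSet_range).2 (by simp)

/-- A nonempty perfect Polish space contains a copy of the Cantor space, hence is uncountable, and
uncountable standard Borel spaces are all isomorphic. -/
theorem exists_equiv_real_of_perfectSpace (X : Type*) [TopologicalSpace X] [PolishSpace X]
    [PerfectSpace X] [Nonempty X] [MeasurableSpace X] [BorelSpace X] : Nonempty (ℝ ≃ᵐ X) := by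
  refine ⟨PolishSpace.measurableEquivOfNotCountable ?_ fun _ => ?_⟩
  · rw [← Cardinal.mk_le_aleph0_iff, not_le, Cardinal.mk_real]
    exact Cardinal.aleph0_lt_continuum
  · let _ := TopologicalSpace.upgradeIsCompletelyMetrizable X
    obtain ⟨f, -, -, hf⟩ := (PerfectSpace.univ_perfect X).exists_nat_bool_injection univ_nonempty
    have := hf.countable
    rw [← Cardinal.mk_le_aleph0_iff, ← not_lt] at this
    exact this (by simp [Cardinal.aleph0_lt_continuum])

/-- On perfect Polish spaces, rationalizability may differ from common belief. -/
theorem exists_RAT_ne_RCBR (CH : Cardinal.continuum.{0} = Cardinal.aleph.{0} 1) (X Y : Type u)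
    [TopologicalSpace X] [PolishSpace X] [PerfectSpace X] [Nonempty X] [MeasurableSpace X]
    [BorelSpace X] [TopologicalSpace Y] [PolishSpace Y] [PerfectSpace Y] [Nonempty Y]
    [MeasurableSpace Y] [BorelSpace Y] :
    ∃ (E : Set (X × ProbabilityMeasure Y)) (F : Set (Y × ProbabilityMeasure X)),
      UniversallyMeasurableSet E ∧ UniversallyMeasurableSet F ∧ RAT E F ≠ RCBR E F := by
  obtain ⟨eX⟩ := exists_equiv_real_of_perfectSpace X
  obtain ⟨eY⟩ := exists_equiv_real_of_perfectSpace Y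
  obtain ⟨f, -, hf⟩ := exists_nullValued CH eX.measurableEmbedding (univ : Set Y)
  obtain ⟨l, hl, -⟩ := exists_diffuse eY.measurableEmbedding
  refine ⟨Prod.snd ⁻¹' {l}, {p | p.1 ∈ univ ∧ p.2 = diracProba (f p.1)},
    fun μ => (measurable_snd (measurableSet_singleton l)).nullMeasurableSet,
    hf.graph_diracProba, fun h => ?_⟩
  have hE : ∀ s, ∃ μ, (s, μ) ∈ (Prod.snd ⁻¹' {l} : Set (X × ProbabilityMeasure Y)) :=
    fun _ => ⟨l, rfl⟩
  have hF : ∀ s, ∃ μ, (s, μ) ∈ {p : Y × ProbabilityMeasure X | p.1 ∈ univ ∧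
      p.2 = diracProba (f p.1)} := fun s =>
    ⟨diracProba (f s), mem_univ s, rfl⟩
  rw [RAT, rat_eq_univ hE hF, rat_eq_univ hF hE, univ_prod_univ] at h
  obtain ⟨x⟩ := ‹Nonempty X›
  obtain ⟨y⟩ := ‹Nonempty Y›
  exact not_mem_rcbr hf hl (by simp) (fun _ h => h) (fun _ _ _ h => h.2)
    (h.subset (mem_univ (x, y))).1

/-! ### Betting games -/

/-- A countable family of events on which no probability measure other than `l` is dominated
by `l`. -/
theorem exists_test_events {S : Type*} [MeasurableSpace S] [MeasurableSpace.CountablyGenerated S]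
    (l : ProbabilityMeasure S) : ∃ A : ℕ → Set S, (∀ n, MeasurableSet (A n)) ∧ (∃ n, A n = ∅) ∧
      ∀ μ : ProbabilityMeasure S,
        (∀ n, (μ : Measure S).real (A n) ≤ (l : Measure S).real (A n)) → μ = l := by
  let C : Set (Set S) := generateSetAlgebra (MeasurableSpace.countableGeneratingSet S)
  have hC : IsSetAlgebra C := isSetAlgebra_generateSetAlgebra
  have hgen : ‹MeasurableSpace S› = MeasurableSpace.generateFrom C := by
    rw [generateFrom_generateSetAlgebra_eq, MeasurableSpace.generateFrom_countableGeneratingSet]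
  obtain ⟨A, hA⟩ := (countable_generateSetAlgebra
    (MeasurableSpace.countable_countableGeneratingSet (α := S))).exists_eq_range ⟨∅, hC.empty_mem⟩
  have hAC : ∀ n, A n ∈ C := fun n => hA.symm.subset (mem_range_self n)
  have hAm : ∀ n, MeasurableSet (A n) := fun n =>
    hgen.symm.le _ (MeasurableSpace.measurableSet_generateFrom (hAC n))
  refine ⟨A, hAm, hA.subset hC.empty_mem, fun μ h => Subtype.ext ?_⟩
  refine ext_of_generate_finite (μ := (μ : Measure S)) (ν := (l : Measure S)) C hgen (fun s hs t ht _ => hC.inter_mem hs ht) ?_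
    ((measure_univ (μ := (μ : Measure S))).trans (measure_univ (μ := (l : Measure S))).symm)
  intro s hs
  obtain ⟨n, rfl⟩ := hA.subset hs
  -- The events form an algebra; domination on the complement is the reverse inequality on `A n`.
  obtain ⟨m, hm⟩ := hA.subset (hC.compl_mem (hAC n))
  have h1 := h m
  rw [hm, probReal_compl_eq_one_sub (hAm n), probReal_compl_eq_one_sub (hAm n)] at h1
  exact (measureReal_eq_measureReal_iff (measure_ne_top (μ : Measure S) _)
    (measure_ne_top (l : Measure S) _)).1 (le_antisymm (h n) (by linarith))

theorem UniversallyMeasurableSet.union {α : Type*} [MeasurableSpace α]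
    {s t : Set α} (hs : UniversallyMeasurableSet s) (ht : UniversallyMeasurableSet t) :
    UniversallyMeasurableSet (s ∪ t) := fun μ => (hs μ).union (ht μ)

theorem UniversallyMeasurableSet.of_measurableSet {α : Type*}
    [MeasurableSpace α] {s : Set α} (hs : MeasurableSet s) : UniversallyMeasurableSet s :=
  fun _ => hs.nullMeasurableSet

/-- The data of a symmetric game in which the strategy `z` is only a best response to the diffuse
belief `l`, which is concentrated on `M`, while a strategy `s` in `M` is only a best response to
the unit mass at `f s`. The strategies in `T` are bets on the events `A n`. -/
structure BettingGame (S : Type*) [MeasurableSpace S] where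
  z : S
  M : Set S
  T : Set S
  l : ProbabilityMeasure S
  f : S → S
  A : ℕ → Set S
  k : S → ℕ
  measurableSet_M : MeasurableSet M
  measurableSet_T : MeasurableSet T
  disjoint : Disjoint M T
  eq_z_iff : ∀ s, s = z ↔ s ∉ M ∧ s ∉ T
  diffuse : NullSingletonClass (l : Measure S)
  ae_mem_M : ∀ᵐ s ∂(l : Measure S), s ∈ M
  nullValued : NullValued f M
  map_mem : ∀ s, f s ∈ T
  measurableSet_A : ∀ n, MeasurableSet (A n)
  exists_eq_empty : ∃ n, A n = ∅
  eq_l : ∀ μ : ProbabilityMeasure S,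
    (∀ n, (μ : Measure S).real (A n) ≤ (l : Measure S).real (A n)) → μ = l
  measurable_k : Measurable k
  exists_bet : ∀ n, ∃ s ∈ T, k s = n

namespace BettingGame

variable {S : Type*} [MeasurableSpace S] (D : BettingGame S)

/-- The gain of a bet on `A n` at the price `l (A n)`, which is called off outside `M`. -/
noncomputable def gain (n : ℕ) (y : S) : ℝ :=
  (D.A n ∩ D.M).indicator 1 y - (D.l : Measure S).real (D.A n) * D.M.indicator 1 y

/-- The expected gain of a bet. -/
noncomputable def expGain (n : ℕ) (μ : ProbabilityMeasure S) : ℝ :=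
  (μ : Measure S).real (D.A n ∩ D.M) -
    (D.l : Measure S).real (D.A n) * (μ : Measure S).real D.M

open Classical in
/-- The payoff of the strategy `s` against the strategy `y`. -/
noncomputable def payoff (s y : S) : ℝ :=
  if s ∈ D.T then 1 + D.gain (D.k s) y else if s ∈ D.M then ({D.f s} : Set S).indicator 1 y
  else D.M.indicator 1 y

theorem measurable_gain (n : ℕ) : Measurable (D.gain n) :=
  (measurable_one.indicator ((D.measurableSet_A n).inter D.measurableSet_M)).sub
    ((measurable_one.indicator D.measurableSet_M).const_mul _)

theorem abs_gain_le (n : ℕ) (y : S) : |D.gain n y| ≤ 1 := by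
  have h0 : 0 ≤ (D.l : Measure S).real (D.A n) := measureReal_nonneg
  have h1 : (D.l : Measure S).real (D.A n) ≤ 1 := measureReal_le_one
  rw [abs_le, gain]
  generalize (D.l : Measure S).real (D.A n) = c at *
  by_cases hM : y ∈ D.M <;> by_cases hA : y ∈ D.A n <;> simp [hM, hA] <;>
    exact ⟨by linarith, by linarith⟩

theorem gain_of_mem_T (n : ℕ) {y : S} (hy : y ∈ D.T) : D.gain n y = 0 := by
  have : y ∉ D.M := fun h => D.disjoint.notMem_of_mem_left h hy
  simp [gain, this]

theorem integral_gain (n : ℕ) (μ : ProbabilityMeasure S) :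
    ∫ y, D.gain n y ∂(μ : Measure S) = D.expGain n μ := by
  have h : ∀ s : Set S, MeasurableSet s → Integrable (s.indicator (1 : S → ℝ)) (μ : Measure S) :=
    fun s hs => (integrable_const 1).indicator hs
  have hAM := (D.measurableSet_A n).inter D.measurableSet_M
  simp only [gain]
  rw [integral_sub (h _ hAM) ((h _ D.measurableSet_M).const_mul _), integral_const_mul,
    integral_indicator_one hAM, integral_indicator_one D.measurableSet_M, expGain]

theorem integrable_gain (n : ℕ) (μ : ProbabilityMeasure S) :
    Integrable (D.gain n) (μ : Measure S) :=
  .of_bound (D.measurable_gain n).aestronglyMeasurable 1 (.of_forall (D.abs_gain_le n))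

theorem abs_payoff_le (s y : S) : |D.payoff s y| ≤ 2 := by
  have h : ∀ t : Set S, |t.indicator (1 : S → ℝ) y| ≤ 2 := fun t => by
    by_cases hy : y ∈ t <;> simp [hy]
  have h1 := D.abs_gain_le (D.k s) y
  unfold payoff
  split_ifs
  · rw [abs_le] at h1 ⊢
    exact ⟨by linarith, by linarith⟩
  · exact h _
  · exact h _

theorem integral_payoff_of_mem_T {s : S} (hs : s ∈ D.T) (μ : ProbabilityMeasure S) :
    ∫ y, D.payoff s y ∂(μ : Measure S) = 1 + D.expGain (D.k s) μ := by
  simp only [payoff, if_pos hs]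
  rw [integral_add (integrable_const 1) (D.integrable_gain _ μ), integral_gain]
  simp

theorem integral_payoff_of_mem_M [MeasurableSingletonClass S] {s : S} (hs : s ∈ D.M)
    (μ : ProbabilityMeasure S) :
    ∫ y, D.payoff s y ∂(μ : Measure S) = (μ : Measure S).real {D.f s} := by
  have : s ∉ D.T := D.disjoint.notMem_of_mem_left hs
  simp only [payoff, if_neg this, if_pos hs]
  exact integral_indicator_one (measurableSet_singleton _)

theorem integral_payoff_z (μ : ProbabilityMeasure S) :
    ∫ y, D.payoff D.z y ∂(μ : Measure S) = (μ : Measure S).real D.M := by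
  have := (D.eq_z_iff D.z).1 rfl
  simp only [payoff, if_neg this.1, if_neg this.2]
  exact integral_indicator_one D.measurableSet_M

theorem trichotomy (s : S) : s ∈ D.T ∨ s ∈ D.M ∨ s = D.z := by
  rw [D.eq_z_iff]
  tauto

theorem exists_expGain_eq_zero : ∃ n, ∀ μ, D.expGain n μ = 0 := by
  obtain ⟨n, hn⟩ := D.exists_eq_empty
  exact ⟨n, fun μ => by simp [expGain, hn]⟩

/-- The pairs of a strategy and a belief to which it is a best response. -/
def bestResponse : Set (S × ProbabilityMeasure S) :=
  {p | ∀ s, ∫ y, D.payoff s y ∂(p.2 : Measure S) ≤ ∫ y, D.payoff p.1 y ∂(p.2 : Measure S)}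

/-- Guesses never earn more than 1 in expectation, and the bet on the empty event earns exactly 1,
so only bets need to be tested as deviations. -/
theorem mem_bestResponse_iff [MeasurableSingletonClass S] (s : S) (μ : ProbabilityMeasure S) :
    (s, μ) ∈ D.bestResponse ↔ (∀ n, 1 + D.expGain n μ ≤ ∫ y, D.payoff s y ∂(μ : Measure S)) := by
  constructor
  · intro h n
    obtain ⟨t, ht, rfl⟩ := D.exists_bet n
    rw [← D.integral_payoff_of_mem_T ht]
    exact h t
  · intro h t
    obtain ⟨n, hn⟩ := D.exists_expGain_eq_zero
    have h1 := h n
    rw [hn] at h1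
    change ∫ y, D.payoff t y ∂(μ : Measure S) ≤ ∫ y, D.payoff s y ∂(μ : Measure S)
    rcases D.trichotomy t with ht | ht | rfl
    · rw [D.integral_payoff_of_mem_T ht]
      exact h _
    · rw [D.integral_payoff_of_mem_M ht]
      exact measureReal_le_one.trans (by linarith)
    · rw [D.integral_payoff_z]
      exact measureReal_le_one.trans (by linarith)

theorem mem_bestResponse_of_mem_T [MeasurableSingletonClass S] {s : S} (hs : s ∈ D.T)
    (μ : ProbabilityMeasure S) :
    (s, μ) ∈ D.bestResponse ↔ ∀ n, D.expGain n μ ≤ D.expGain (D.k s) μ := by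
  simp [mem_bestResponse_iff, D.integral_payoff_of_mem_T hs]

/-- Since `T` is disjoint from `M`, all bets are called off at a point of `T`. -/
theorem expGain_diracProba [MeasurableSingletonClass S] {t : S} (ht : t ∈ D.T) (n : ℕ) :
    D.expGain n (diracProba t) = 0 := by
  rw [← integral_gain]
  exact (integral_dirac _ _).trans (D.gain_of_mem_T n ht)

/-- Matching the null bet forces `μ {f s} = 1`. Conversely `f s ∈ T`, so against its unit mass every
bet earns just 1. -/
theorem mem_bestResponse_of_mem_M [MeasurableSingletonClass S] {s : S} (hs : s ∈ D.M)
    (μ : ProbabilityMeasure S) :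
    (s, μ) ∈ D.bestResponse ↔ μ = diracProba (D.f s) := by
  rw [mem_bestResponse_iff, D.integral_payoff_of_mem_M hs]
  constructor
  · intro h
    obtain ⟨n, hn⟩ := D.exists_expGain_eq_zero
    have h1 := h n
    rw [hn, add_zero] at h1
    have h2 : (μ : Measure S) {D.f s} = 1 := by
      rw [← ENNReal.toReal_eq_one_iff]
      exact le_antisymm measureReal_le_one h1
    refine Subtype.ext ?_
    have h3 : ∀ᵐ y ∂(μ : Measure S), y = D.f s :=
      (mem_ae_iff_prob_eq_one (measurableSet_singleton _)).2 h2
    change (μ : Measure S) = Measure.dirac (D.f s)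
    rw [← Measure.map_id (μ := (μ : Measure S)),
      Measure.map_congr (f := id) (g := fun _ => D.f s) h3, Measure.map_const]
    simp
  · rintro rfl n
    rw [D.expGain_diracProba (D.map_mem s)]
    simp [diracProba, Measure.real]

/-- Matching the null bet forces `μ M = 1`. Then the gain of bet `n` is `μ (A n) - l (A n)`, and no
bet is profitable only if `μ` is dominated by `l` on all test events, that is, `μ = l`. -/
theorem mem_bestResponse_z [MeasurableSingletonClass S] (μ : ProbabilityMeasure S) :
    (D.z, μ) ∈ D.bestResponse ↔ μ = D.l := by
  have key : ∀ ν : ProbabilityMeasure S, (ν : Measure S).real D.M = 1 → ∀ n,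
      D.expGain n ν = (ν : Measure S).real (D.A n) - (D.l : Measure S).real (D.A n) := by
    intro ν hν n
    have : (ν : Measure S) D.M = 1 := by rwa [← ENNReal.toReal_eq_one_iff]
    rw [expGain, hν, mul_one, inter_comm, measureReal_def,
      Measure.measure_inter_eq_of_ae ((mem_ae_iff_prob_eq_one D.measurableSet_M).2 this)]
    rfl
  rw [mem_bestResponse_iff, D.integral_payoff_z]
  constructor
  · intro h
    obtain ⟨n, hn⟩ := D.exists_expGain_eq_zero
    have h1 := h n
    rw [hn, add_zero] at h1
    have h2 := le_antisymm measureReal_le_one h1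
    refine D.eq_l μ fun n => ?_
    have := h n
    rw [key μ h2, h2] at this
    linarith
  · rintro rfl n
    have h2 : (D.l : Measure S).real D.M = 1 := by
      rw [measureReal_def, (mem_ae_iff_prob_eq_one D.measurableSet_M).1 D.ae_mem_M]
      rfl
    rw [key _ h2, h2]
    linarith

/-- A bet is optimal against its own unit mass, where all bets tie; this is what makes every
strategy rationalizable. -/
theorem exists_mem_bestResponse [MeasurableSingletonClass S] (s : S) :
    ∃ μ, (s, μ) ∈ D.bestResponse := by
  rcases D.trichotomy s with hs | hs | rfl
  · exact ⟨diracProba s, (D.mem_bestResponse_of_mem_T hs _).2 fun n => by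
      simp [D.expGain_diracProba hs]⟩
  · exact ⟨_, (D.mem_bestResponse_of_mem_M hs _).2 rfl⟩
  · exact ⟨_, (D.mem_bestResponse_z _).2 rfl⟩

theorem bestResponse_eq [MeasurableSingletonClass S] :
    D.bestResponse = {(D.z, D.l)} ∪ {p | p.1 ∈ D.M ∧ p.2 = diracProba (D.f p.1)} ∪
      {p | p.1 ∈ D.T ∧ ∀ n, D.expGain n p.2 ≤ D.expGain (D.k p.1) p.2} := by
  ext ⟨s, μ⟩
  have hz := D.eq_z_iff s
  rcases D.trichotomy s with hs | hs | rfl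
  · have hM : s ∉ D.M := fun h => D.disjoint.notMem_of_mem_left h hs
    simp [D.mem_bestResponse_of_mem_T hs, hs, hM, hz]
  · have hT : s ∉ D.T := D.disjoint.notMem_of_mem_left hs
    simp [D.mem_bestResponse_of_mem_M hs, hs, hT, hz]
  · simp [D.mem_bestResponse_z, hz.1 rfl]

theorem measurable_expGain (n : ℕ) : Measurable (D.expGain n) := by
  have h : ∀ s : Set S, MeasurableSet s →
      Measurable fun μ : ProbabilityMeasure S => (μ : Measure S).real s := fun s hs =>
    ((Measure.measurable_coe hs).comp measurable_subtype_coe).ennreal_toReal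
  exact (h _ ((D.measurableSet_A n).inter D.measurableSet_M)).sub
    ((h _ D.measurableSet_M).const_mul _)

/-- Apart from the graph of unit masses everything is Borel: the part over `T` is given by countably
many inequalities between Borel functions. -/
theorem universallyMeasurableSet_bestResponse [StandardBorelSpace S] :
    UniversallyMeasurableSet D.bestResponse := by
  rw [bestResponse_eq]
  refine ((UniversallyMeasurableSet.of_measurableSet (measurableSet_singleton _)).union
    D.nullValued.graph_diracProba).union (.of_measurableSet ?_)
  have h : Measurable fun p : ℕ × ProbabilityMeasure S => D.expGain p.1 p.2 :=
    measurable_from_prod_countable_right D.measurable_expGain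
  have hk : Measurable fun p : S × ProbabilityMeasure S => D.expGain (D.k p.1) p.2 :=
    h.comp ((D.measurable_k.comp measurable_fst).prodMk measurable_snd)
  refine (measurable_fst D.measurableSet_T).inter ?_
  exact measurableSet_setOfPred.2 <| .forall fun n => measurableSet_setOfPred.1 <|
    measurableSet_le ((D.measurable_expGain n).comp measurable_snd) hk

theorem universallyMeasurable_payoff [StandardBorelSpace S] :
    UniversallyMeasurable fun p : S × S => D.payoff p.1 p.2 := by
  classical
  have hg : Measurable fun p : S × S => D.gain (D.k p.1) p.2 :=
    (measurable_from_prod_countable_right (f := fun p : ℕ × S => D.gain p.1 p.2)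
      D.measurable_gain).comp ((D.measurable_k.comp measurable_fst).prodMk measurable_snd)
  -- The payoff with the winning guesses of the strategies in `M` erased. It is Borel, and differs
  -- from the payoff only on the graph of `f` over `M`, where the payoff is 1.
  let g : S × S → ℝ := fun p => if p.1 ∈ D.T then 1 + D.gain (D.k p.1) p.2
    else if p.1 ∈ D.M then 0 else D.M.indicator 1 p.2
  have hg : Measurable g := .ite (measurable_fst D.measurableSet_T) (hg.const_add 1)
    (.ite (measurable_fst D.measurableSet_M) measurable_const
      ((measurable_one.indicator D.measurableSet_M).comp measurable_snd))
  have hG := D.nullValued.graph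
  intro s hs μ
  have h : (fun p : S × S => D.payoff p.1 p.2) =
      {p : S × S | p.1 ∈ D.M ∧ p.2 = D.f p.1}.piecewise (1 : S × S → ℝ) g := by
    ext ⟨x, y⟩
    by_cases hx : x ∈ D.M
    · have hT : x ∉ D.T := D.disjoint.notMem_of_mem_left hx
      by_cases hy : y = D.f x <;> simp [payoff, g, piecewise, hx, hT, hy]
    · simp [payoff, g, piecewise, hx]
  rw [h, piecewise_preimage]
  exact ((measurable_one hs).nullMeasurableSet.inter (hG μ)).union
    ((hg hs).nullMeasurableSet.diff (hG μ))

end BettingGame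

/-! ### The game on the interval -/

/-- The symmetric two-person game with the payoffs of a betting game. -/
noncomputable def BettingGame.toGame {S : Type u} [MeasurableSpace S] [StandardBorelSpace S]
    (D : BettingGame S) : Game S S where
  payoff₁ x y := D.payoff x y
  payoff₂ x y := D.payoff y x
  bounded₁ := ⟨2, D.abs_payoff_le⟩
  bounded₂ := ⟨2, fun x y => D.abs_payoff_le y x⟩
  measurable₁ := D.universallyMeasurable_payoff
  measurable₂ s hs μ := by
    exact (D.universallyMeasurable_payoff s hs (μ.map measurable_swap.aemeasurable)).preimage
      (measurable_swap.quasiMeasurePreserving _)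

theorem BettingGame.z_not_mem_rcbr {S : Type u} [MeasurableSpace S] [StandardBorelSpace S]
    (D : BettingGame S) : D.z ∉ rcbr D.bestResponse D.bestResponse :=
  not_mem_rcbr D.nullValued D.diffuse D.ae_mem_M (fun μ => (D.mem_bestResponse_z μ).1)
    fun _ hy μ => (D.mem_bestResponse_of_mem_M hy μ).1

/-- The interval splits into `z = 0`, `M = (0,1]` and `T = (1,2]`. Sigmoid copies of the line in
`(0,1)` and `(1,2)` carry the diffuse belief and the values of `f`. -/
theorem exists_bettingGame (CH : Cardinal.continuum.{0} = Cardinal.aleph.{0} 1) :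
    ∃ D : BettingGame (Icc (0 : ℝ) 2), (D.z : ℝ) = 0 := by
  have h0 : ∀ x, 0 < Real.sigmoid x := Real.sigmoid_pos
  have h1 : ∀ x, Real.sigmoid x < 1 := Real.sigmoid_lt_one
  let i : ℝ → Icc (0 : ℝ) 2 := fun x => ⟨Real.sigmoid x, (h0 x).le, by linarith [h1 x]⟩
  let j : ℝ → Icc (0 : ℝ) 2 := fun x => ⟨1 + Real.sigmoid x, by linarith [h0 x], by linarith [h1 x]⟩
  have hi : MeasurableEmbedding i := Continuous.measurableEmbedding
    (continuous_sigmoid.subtype_mk _)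
    fun x y h => Real.sigmoid_strictMono.injective (congrArg Subtype.val h)
  have hj : MeasurableEmbedding j := Continuous.measurableEmbedding
    ((continuous_sigmoid.const_add 1).subtype_mk _)
    fun x y h => Real.sigmoid_strictMono.injective (add_left_cancel (congrArg Subtype.val h))
  obtain ⟨l, hl, hli⟩ := exists_diffuse hi
  obtain ⟨f, hfj, hf⟩ := exists_nullValued CH hj {s : Icc (0 : ℝ) 2 | 0 < (s : ℝ) ∧ (s : ℝ) ≤ 1}
  obtain ⟨A, hAm, hA0, hA⟩ := exists_test_events l
  refine ⟨{
    z := ⟨0, by simp⟩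
    M := {s | 0 < (s : ℝ) ∧ (s : ℝ) ≤ 1}
    T := {s | 1 < (s : ℝ)}
    l := l
    f := f
    A := A
    -- Bet `n` is placed by `s = 1 + 1/(n+1)`, with `s = 2` giving `n = 0`. On `T` the floor is at
    -- least 1, so the subtraction does not truncate; values off `T` never enter the payoff.
    k := fun s => ⌊1 / ((s : ℝ) - 1)⌋₊ - 1
    measurableSet_M := (measurableSet_lt measurable_const measurable_subtype_coe).inter
      (measurableSet_le measurable_subtype_coe measurable_const)
    measurableSet_T := measurableSet_lt measurable_const measurable_subtype_coe
    disjoint := disjoint_left.2 fun s hs hs' => not_lt.2 hs.2 hs'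
    eq_z_iff := fun s => ?_
    diffuse := hl
    ae_mem_M := ?_
    nullValued := hf
    map_mem := fun s => ?_
    measurableSet_A := hAm
    exists_eq_empty := hA0
    eq_l := hA
    measurable_k := ?_
    exists_bet := fun n => ?_ }, rfl⟩
  · have := s.2.1
    simp only [Subtype.ext_iff, mem_ofPred_eq, not_and, not_le, not_lt]
    constructor
    · intro h
      rw [h]
      norm_num
    · rintro ⟨h, h'⟩
      by_contra hne
      exact absurd (h (lt_of_le_of_ne this (Ne.symm hne))) (not_lt.2 h')
  · filter_upwards [hli]
    rintro _ ⟨x, rfl⟩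
    exact ⟨h0 x, (h1 x).le⟩
  · obtain ⟨x, hx⟩ := hfj (mem_range_self s)
    rw [← hx]
    exact lt_add_of_pos_right 1 (h0 x)
  · exact (measurable_of_countable fun n : ℕ => n - 1).comp
      (Nat.measurable_floor.comp ((measurable_subtype_coe.sub_const 1).const_div 1))
  · have hn : (0 : ℝ) < 1 / ((n : ℝ) + 1) := by positivity
    have hn1 : 1 / ((n : ℝ) + 1) ≤ 1 := by
      rw [div_le_one (by positivity)]
      linarith [(n.cast_nonneg : (0 : ℝ) ≤ n)]
    refine ⟨⟨1 + 1 / ((n : ℝ) + 1), by linarith, by linarith⟩, lt_add_of_pos_right 1 hn, ?_⟩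
    have h : 1 / ((1 + 1 / ((n : ℝ) + 1)) - 1) = ((n + 1 : ℕ) : ℝ) := by
      rw [add_sub_cancel_left, one_div_one_div]
      push_cast
      rfl
    simp only [h, Nat.floor_natCast, Nat.add_sub_cancel]

end Epistemic

theorem theorem5 (CH : Cardinal.continuum.{0} = Cardinal.aleph.{0} 1) :
    (∃ G : Epistemic.Game (Set.Icc (0 : ℝ) 2) (Set.Icc (0 : ℝ) 2),
      Epistemic.UniversallyMeasurableSet G.bestResponse₁ ∧
      Epistemic.UniversallyMeasurableSet G.bestResponse₂ ∧
      (∀ s : Set.Icc (0 : ℝ) 2, (s : ℝ) = 0 →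
        (s ∈ G.rationalizable₁ ∧ s ∉ G.rcbr₁) ∧ (s ∈ G.rationalizable₂ ∧ s ∉ G.rcbr₂))) ∧
    (∀ (X₁ X₂ : Type u)
      [TopologicalSpace X₁] [PolishSpace X₁] [PerfectSpace X₁] [Nonempty X₁]
      [MeasurableSpace X₁] [BorelSpace X₁]
      [TopologicalSpace X₂] [PolishSpace X₂] [PerfectSpace X₂] [Nonempty X₂]
      [MeasurableSpace X₂] [BorelSpace X₂],
      ∃ (E₁ : Set (X₁ × MeasureTheory.ProbabilityMeasure X₂))
        (E₂ : Set (X₂ × MeasureTheory.ProbabilityMeasure X₁)),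
        Epistemic.UniversallyMeasurableSet E₁ ∧ Epistemic.UniversallyMeasurableSet E₂ ∧
        Epistemic.RAT E₁ E₂ ≠ Epistemic.RCBR E₁ E₂) := by
  refine ⟨?_, fun X₁ X₂ => Epistemic.exists_RAT_ne_RCBR CH X₁ X₂⟩
  obtain ⟨D, hD⟩ := Epistemic.exists_bettingGame CH
  have hE := D.exists_mem_bestResponse
  refine ⟨D.toGame, D.universallyMeasurableSet_bestResponse,
    D.universallyMeasurableSet_bestResponse, fun s hs => ?_⟩
  obtain rfl : s = D.z := Subtype.ext (hs.trans hD.symm)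
  refine ⟨⟨fun α => ?_, D.z_not_mem_rcbr⟩, ⟨fun α => ?_, D.z_not_mem_rcbr⟩⟩
  · exact (congrArg Prod.fst (Epistemic.stage_eq_univ hE hE α)).symm.subset (mem_univ _)
  · exact (congrArg Prod.snd (Epistemic.stage_eq_univ hE hE α)).symm.subset (mem_univ _)
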